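/- Let $\pi\colon\mathbb{R}^2\to\mathbb{T}^2=\mathbb{R}^2/\mathbb{Z}^2$ be the canonical projection. There exists an open set $\hat U\subset\mathbb{R}^2$ such that: (1) $\hat U$ is connected and simply connected; (2) $U=\pi(\hat U)$ is simply connected, or equivalently, $\hat U$ is disjoint from $\hat U+v$ for all $v\in\mathbb{Z}^2$, $v\neq(0,0)$; (3) $\hat U$ intersects every square $[0,1]^2+v$ with $v\in\mathbb{R}^2$; in particular, $\hat U$ accumulates in every direction at infinity, that is, for every $v\in\mathbb{R}^2$ with $\|v\|=1$ (Euclidean norm) there is a sequence $(x_n)_{n\geq 0}$ in $\hat U$ such that $\lim_{n\to\infty}\|x_n\|=\infty$ and $\lim_{n\to\infty}\frac{x_n-x_0}{\|x_n-x_0\|}=v$; (4) $U$ has full Lebesgue measure in $\mathbb{T}^2$, i.e. $\mathbb{T}^2\setminus U$ is a Lebesgue null set. -/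

import Mathlib

open Set Filter Topology MeasureTheory

open scoped Pointwise

/-- The Euclidean plane `ℝ²`. -/
abbrev Plane : Type := EuclideanSpace ℝ (Fin 2)

/-- The covering projection `π : ℝ² → 𝕋² = ℝ² / ℤ²`. The torus `UnitAddTorus (Fin 2)` carries the
product topology and, as its `volume`, the Lebesgue probability measure. -/
def torusProj (x : Plane) : UnitAddTorus (Fin 2) := fun i => (x i : UnitAddCircle)

/-- The point of `ℝ²` with the given integer coordinates. -/
noncomputable def latticePoint (v : Fin 2 → ℤ) : Plane := WithLp.toLp 2 fun i => (v i : ℝ)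

/-- The closed unit square `[0,1]²`. -/
def unitSquare : Set Plane := {x | ∀ i, x i ∈ Icc (0 : ℝ) 1}

/-- `X` accumulates in the direction `v` at infinity: there is a sequence `x₀, x₁, …` in `X` with
`‖xₙ‖ → ∞` and `(xₙ - x₀) / ‖xₙ - x₀‖ → v`. -/
def AccumulatesInDirection (X : Set Plane) (v : Plane) : Prop :=
  ∃ x : ℕ → Plane, (∀ n, x n ∈ X) ∧ Tendsto (fun n => ‖x n‖) atTop atTop ∧
    Tendsto (fun n => ‖x n - x 0‖⁻¹ • (x n - x 0)) atTop (𝓝 v)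

/-! ### The covering projection -/

/-! The set is the image of the open unit square under a limit `h` of homeomorphisms `f n` of the
plane, each covering a measure preserving homeomorphism of the torus. Passing from `f n` to `f (n +
1)` changes nothing at distance at least `δ n` from the integer grid, and `δ n → 0`. So near every
point of the open square the sequence is eventually stationary, and `torusProj ∘ h` is an open
embedding (`exists_limit`). This gives simple connectedness upstairs and downstairs, and
disjointness of the translates. The complement of the projected image lies, for every `n`, in the
image of the `δ n`-neighbourhood of the grid, whose measure tends to `0`.

To reach every cell of mesh 1/2, an invariant is kept (`IsStage`): each cell meets the images of two
different unit squares. The preimage of a cell is connected, so it crosses a grid line at some `p`.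
Shears supported near the grid carry a point of the open square to `p`, and precomposing with them
makes the image of the square meet the cell (`IsStage.exists_next`). -/

theorem continuous_torusProj : Continuous torusProj :=
  continuous_pi fun i => (AddCircle.continuous_mk' 1).comp (by fun_prop)

theorem isOpenMap_torusProj : IsOpenMap torusProj :=
  (IsOpenMap.piMap (fun _ => QuotientAddGroup.isOpenMap_coe)
    (Eventually.of_forall fun _ => QuotientAddGroup.mk_surjective)).comp
    (PiLp.homeomorph 2 fun _ : Fin 2 => ℝ).isOpenMap

theorem torusProj_surjective : Function.Surjective torusProj := fun y => by
  choose x hx using fun i => QuotientAddGroup.mk_surjective (y i)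
  exact ⟨WithLp.toLp 2 x, funext hx⟩

theorem coe_intCast_unitAddCircle (m : ℤ) : ((m : ℝ) : UnitAddCircle) = 0 :=
  AddCircle.coe_eq_zero_iff 1 |>.2 ⟨m, by simp⟩

theorem torusProj_latticePoint_vadd (v : Fin 2 → ℤ) (x : Plane) :
    torusProj (latticePoint v +ᵥ x) = torusProj x := by
  ext i
  simp [torusProj, latticePoint, coe_intCast_unitAddCircle]

/-- The open unit square `(0,1)²`. -/
def openUnitSquare : Set Plane := {x | ∀ i, x i ∈ Ioo (0 : ℝ) 1}

theorem convex_openUnitSquare : Convex ℝ openUnitSquare := by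
  intro x hx y hy a b ha hb hab i
  exact convex_Ioo (0 : ℝ) 1 (hx i) (hy i) ha hb hab

theorem isOpen_openUnitSquare : IsOpen openUnitSquare := by
  simp only [openUnitSquare, ofPred_forall]
  exact isOpen_iInter_of_finite fun i => isOpen_Ioo.preimage (by fun_prop)

theorem injOn_torusProj_openUnitSquare : InjOn torusProj openUnitSquare := by
  intro x hx y hy h
  ext i
  have hi := congrFun h i
  exact (AddCircle.coe_eq_coe_iff_of_mem_Ico (p := (1 : ℝ)) (a := 0)
    ⟨(hx i).1.le, by simpa using (hx i).2⟩ ⟨(hy i).1.le, by simpa using (hy i).2⟩).1 hi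

theorem le_norm_coe_unitAddCircle {δ x : ℝ} (h : ∀ m : ℤ, δ ≤ |x - m|) :
    δ ≤ ‖(x : UnitAddCircle)‖ := by
  rw [UnitAddCircle.norm_eq]
  exact h _

theorem norm_coe_unitAddCircle_eq {x : ℝ} (m : ℤ) (h : |x - m| ≤ 1 / 2) :
    ‖(x : UnitAddCircle)‖ = |x - m| := by
  rw [← (AddCircle.norm_coe_eq_abs_iff (1 : ℝ) one_ne_zero).2 (by simpa using h)]
  rw [AddCircle.coe_sub, coe_intCast_unitAddCircle, sub_zero]

theorem norm_coe_unitAddCircle_int (m : ℤ) : ‖((m : ℝ) : UnitAddCircle)‖ = 0 := by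
  rw [norm_coe_unitAddCircle_eq m (by simp)]
  simp

theorem norm_coe_unitAddCircle_pos {x : ℝ} (hx : x ∈ Ioo (0 : ℝ) 1) :
    0 < ‖(x : UnitAddCircle)‖ := by
  refine (lt_min hx.1 (sub_pos.2 hx.2)).trans_le (le_norm_coe_unitAddCircle fun m => ?_)
  rcases le_or_gt m 0 with hm | hm
  · have : (m : ℝ) ≤ 0 := mod_cast hm
    exact (min_le_left _ _).trans (le_abs.2 (Or.inl (by linarith)))
  · have : (1 : ℝ) ≤ m := mod_cast hm
    exact (min_le_right _ _).trans (le_abs.2 (Or.inr (by linarith)))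

/-- The points of the plane at distance at least `δ` from the lines of the integer grid. -/
def gridThickComplement (δ : ℝ) : Set Plane := {x | ∀ i, δ ≤ ‖(x i : UnitAddCircle)‖}

theorem gridThickComplement_anti {δ ε : ℝ} (h : δ ≤ ε) :
    gridThickComplement ε ⊆ gridThickComplement δ := fun _ hx i => h.trans (hx i)

theorem exists_mem_gridThickComplement {x : Plane} (hx : x ∈ openUnitSquare) :
    ∃ δ > 0, x ∈ gridThickComplement δ :=
  ⟨min ‖(x 0 : UnitAddCircle)‖ ‖(x 1 : UnitAddCircle)‖,
    lt_min (norm_coe_unitAddCircle_pos (hx 0)) (norm_coe_unitAddCircle_pos (hx 1)),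
    Fin.forall_fin_two.2 ⟨min_le_left _ _, min_le_right _ _⟩⟩

/-! ### Shears -/

/-- The shear `x ↦ x + φ(x_{i+1}) eᵢ` of the plane. -/
noncomputable def planeShear (i : Fin 2) (φ : C(UnitAddCircle, ℝ)) : Plane ≃ₜ Plane where
  toFun x := x + φ (x (i + 1) : UnitAddCircle) • EuclideanSpace.single i (1 : ℝ)
  invFun x := x - φ (x (i + 1) : UnitAddCircle) • EuclideanSpace.single i (1 : ℝ)
  left_inv x := by simp
  right_inv x := by simp
  continuous_toFun := by
    have : Continuous fun x : Plane => (x (i + 1) : UnitAddCircle) :=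
      (AddCircle.continuous_mk' 1).comp (by fun_prop)
    fun_prop
  continuous_invFun := by
    have : Continuous fun x : Plane => (x (i + 1) : UnitAddCircle) :=
      (AddCircle.continuous_mk' 1).comp (by fun_prop)
    fun_prop

theorem planeShear_apply_self (i : Fin 2) (φ : C(UnitAddCircle, ℝ)) (x : Plane) :
    planeShear i φ x i = x i + φ (x (i + 1) : UnitAddCircle) := by
  simp [planeShear]

theorem planeShear_apply_add_one (i : Fin 2) (φ : C(UnitAddCircle, ℝ)) (x : Plane) :
    planeShear i φ x (i + 1) = x (i + 1) := by
  simp [planeShear]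

theorem planeShear_eq_self {i : Fin 2} {φ : C(UnitAddCircle, ℝ)} {x : Plane}
    (h : φ (x (i + 1) : UnitAddCircle) = 0) : planeShear i φ x = x := by
  simp [planeShear, h]

/-- The shear `x ↦ x + φ(x_{i+1}) eᵢ` of the torus. -/
noncomputable def torusShear (i : Fin 2) (φ : C(UnitAddCircle, ℝ)) :
    UnitAddTorus (Fin 2) ≃ₜ UnitAddTorus (Fin 2) where
  toFun x := x + Pi.single i (φ (x (i + 1)) : UnitAddCircle)
  invFun x := x - Pi.single i (φ (x (i + 1)) : UnitAddCircle)
  left_inv x := by simp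
  right_inv x := by simp
  continuous_toFun := by
    have : Continuous fun x : UnitAddTorus (Fin 2) => (φ (x (i + 1)) : UnitAddCircle) :=
      (AddCircle.continuous_mk' 1).comp (by fun_prop)
    exact continuous_id.add ((continuous_single i).comp this)
  continuous_invFun := by
    have : Continuous fun x : UnitAddTorus (Fin 2) => (φ (x (i + 1)) : UnitAddCircle) :=
      (AddCircle.continuous_mk' 1).comp (by fun_prop)
    exact continuous_id.sub ((continuous_single i).comp this)

theorem torusProj_planeShear (i : Fin 2) (φ : C(UnitAddCircle, ℝ)) (x : Plane) :
    torusProj (planeShear i φ x) = torusShear i φ (torusProj x) := by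
  ext j
  by_cases h : j = i
  · subst h
    simp [torusProj, planeShear, torusShear]
  · simp [torusProj, planeShear, torusShear, h]

/-- A shear is a skew product whose fibre maps are rotations of the circle. For `i = 0` the factors
are swapped so that the base comes first. -/
theorem measurePreserving_torusShear (i : Fin 2) (φ : C(UnitAddCircle, ℝ)) :
    MeasurePreserving (torusShear i φ) volume volume := by
  have hφ : Continuous fun x : UnitAddCircle => (φ x : UnitAddCircle) :=
    (AddCircle.continuous_mk' 1).comp φ.continuous
  have hprod : MeasurePreserving
      (fun p : UnitAddCircle × UnitAddCircle => (p.1, p.2 + (φ p.1 : UnitAddCircle)))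
      (volume.prod volume) (volume.prod volume) :=
    (MeasurePreserving.id _).skew_product (g := fun a b => b + (φ a : UnitAddCircle))
      (by dsimp only [Function.uncurry_def]; fun_prop)
      (Eventually.of_forall fun a => map_add_right_eq_self _ _)
  have hswap : MeasurePreserving (Prod.swap : UnitAddCircle × UnitAddCircle → _)
      (volume.prod volume) (volume.prod volume) := Measure.measurePreserving_swap
  have he := volume_preserving_finTwoArrow UnitAddCircle
  have he' := he.symm
  fin_cases i
  · convert (he'.comp hswap).comp (hprod.comp (hswap.comp he)) using 1
    ext x j
    fin_cases j <;> simp [torusShear, MeasurableEquiv.finTwoArrow]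
  · convert he'.comp (hprod.comp he) using 1
    ext x j
    fin_cases j <;> simp [torusShear, MeasurableEquiv.finTwoArrow]

/-- `f` covers a measure preserving homeomorphism of the torus. -/
def CoversMeasurePreserving (f : Plane ≃ₜ Plane) : Prop :=
  ∃ F : UnitAddTorus (Fin 2) ≃ₜ UnitAddTorus (Fin 2),
    MeasurePreserving F volume volume ∧ ∀ x, torusProj (f x) = F (torusProj x)

theorem coversMeasurePreserving_planeShear (i : Fin 2) (φ : C(UnitAddCircle, ℝ)) :
    CoversMeasurePreserving (planeShear i φ) :=
  ⟨torusShear i φ, measurePreserving_torusShear i φ, torusProj_planeShear i φ⟩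

theorem CoversMeasurePreserving.trans {f g : Plane ≃ₜ Plane} (hf : CoversMeasurePreserving f)
    (hg : CoversMeasurePreserving g) : CoversMeasurePreserving (f.trans g) := by
  obtain ⟨F, hF, hfF⟩ := hf
  obtain ⟨G, hG, hgG⟩ := hg
  exact ⟨F.trans G, hG.comp hF, fun x => by simp [hfF, hgG]⟩

/-- A tent function on the circle supported in the ball of radius `δ` about `0`. -/
noncomputable def circleTent (δ c : ℝ) : C(UnitAddCircle, ℝ) where
  toFun x := c * max 0 (δ - ‖x‖)

theorem circleTent_eq_zero {δ : ℝ} (c : ℝ) {x : UnitAddCircle} (h : δ ≤ ‖x‖) :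
    circleTent δ c x = 0 := by
  simp [circleTent, h]

theorem exists_circleTent_eq {δ : ℝ} {x : UnitAddCircle} (h : ‖x‖ < δ) (a : ℝ) :
    ∃ c, circleTent δ c x = a := by
  have h' : 0 < δ - ‖x‖ := sub_pos.2 h
  refine ⟨a / (δ - ‖x‖), ?_⟩
  simp only [circleTent, ContinuousMap.coe_mk, max_eq_right h'.le]
  field_simp

/-- A point with an integer coordinate can be moved into the open unit square by a homeomorphism
supported near the integer grid. -/
theorem exists_fixing_gridThickComplement {δ : ℝ} (h0 : 0 < δ) (h1 : δ ≤ 1 / 2) {p : Plane}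
    {i : Fin 2} {m : ℤ} (hp : p i = m) :
    ∃ g : Plane ≃ₜ Plane, CoversMeasurePreserving g ∧ (∀ x ∈ gridThickComplement δ, g x = x) ∧
      ∃ q ∈ openUnitSquare, g q = p := by
  have hδ : ‖((δ / 2 : ℝ) : UnitAddCircle)‖ < δ := by
    rw [norm_coe_unitAddCircle_eq 0 (by rw [abs_le]; constructor <;> norm_num <;> linarith)]
    rw [Int.cast_zero, sub_zero, abs_of_pos (by linarith)]
    linarith
  have hm : ‖((m : ℝ) : UnitAddCircle)‖ < δ := by rwa [norm_coe_unitAddCircle_int]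
  -- The source `q` has coordinates `1/2` and `δ/2`. Being `δ/2` from a grid line, it can be sheared
  -- until coordinate `i` equals `m`. That puts it on a grid line in the other direction, so a
  -- second shear can correct coordinate `i + 1`.
  obtain ⟨c, hc⟩ := exists_circleTent_eq hδ (m - 1 / 2)
  obtain ⟨d, hd⟩ := exists_circleTent_eq hm (p (i + 1) - δ / 2)
  refine ⟨(planeShear i (circleTent δ c)).trans (planeShear (i + 1) (circleTent δ d)),
    (coversMeasurePreserving_planeShear _ _).trans (coversMeasurePreserving_planeShear _ _),
    fun x hx => ?_, ?_⟩
  · rw [Homeomorph.trans_apply, planeShear_eq_self (circleTent_eq_zero c (hx _)),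
      planeShear_eq_self (circleTent_eq_zero d (hx _))]
  · have hii : i + 1 + 1 = i := by fin_cases i <;> rfl
    have hne : i + 1 ≠ i := by fin_cases i <;> decide
    set q : Plane := WithLp.toLp 2 fun j => if j = i then 1 / 2 else δ / 2 with hq
    have hqi : q i = 1 / 2 := by simp [hq]
    have hqj : q (i + 1) = δ / 2 := by simp [hq, hne]
    have hri : planeShear i (circleTent δ c) q i = m := by
      rw [planeShear_apply_self, hqi, hqj, hc]; ring
    refine ⟨q, fun j => ?_, ?_⟩
    · by_cases hj : j = i
      · subst hj; rw [hqi]; norm_num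
      · have : q j = δ / 2 := by simp [hq, hj]
        rw [this]; constructor <;> linarith
    · ext j
      by_cases hj : j = i
      · subst hj
        have := planeShear_apply_add_one (j + 1) (circleTent δ d) (planeShear j (circleTent δ c) q)
        rw [hii] at this
        rw [Homeomorph.trans_apply, this, hri, hp]
      · have hj' : j = i + 1 := by revert hj; fin_cases i <;> fin_cases j <;> simp
        subst hj'
        rw [Homeomorph.trans_apply, planeShear_apply_self, planeShear_apply_add_one, hqj, hii,
          hri, hd]
        ring

/-! ### The inductive construction -/

/-- The open cells of the grid of mesh `1/2`. -/
def halfCell (k : Fin 2 → ℤ) : Set Plane :=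
  {x | ∀ i, x i ∈ Ioo ((k i : ℝ) / 2) ((k i + 1) / 2)}

theorem convex_halfCell (k : Fin 2 → ℤ) : Convex ℝ (halfCell k) := by
  intro x hx y hy a b ha hb hab i
  exact convex_Ioo _ _ (hx i) (hy i) ha hb hab

/-- Mesh 1/2 suffices because `⌈2t⌉ < 2t + 1`: rounding up costs less than one cell width. -/
theorem exists_halfCell_subset_vadd_unitSquare (v : Plane) :
    ∃ k, halfCell k ⊆ v +ᵥ unitSquare := by
  refine ⟨fun i => ⌈2 * v i⌉, fun x hx => ⟨x - v, fun i => ?_, by simp⟩⟩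
  have h := hx i
  have h1 := Int.le_ceil (2 * v i)
  have h2 := Int.ceil_lt_add_one (2 * v i)
  simp only [PiLp.sub_apply]
  constructor <;> linarith [h.1, h.2]

theorem IsPreconnected.exists_eq_intCast {s : Set Plane} (hs : IsPreconnected s) {a b : Plane}
    (ha : a ∈ s) (hb : b ∈ s) {i : Fin 2} (h : ⌊a i⌋ ≠ ⌊b i⌋) :
    ∃ p ∈ s, ∃ m : ℤ, p i = m := by
  wlog hlt : ⌊a i⌋ < ⌊b i⌋ generalizing a b
  · exact this hb ha h.symm (lt_of_le_of_ne (not_lt.1 hlt) h.symm)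
  obtain ⟨p, hp, hpm⟩ := hs.intermediate_value ha hb (f := fun x : Plane => x i) (by fun_prop)
    (show (⌊b i⌋ : ℝ) ∈ Icc (a i) (b i) from
      ⟨(Int.floor_lt.1 hlt).le, Int.floor_le _⟩)
  exact ⟨p, hp, _, hpm⟩

/-- The invariant of the construction: every cell of the half grid meets the images of two distinct
components of the complement of the `δ`-thickened integer grid. -/
structure IsStage (f : Plane ≃ₜ Plane) (δ : ℝ) : Prop where
  covers : CoversMeasurePreserving f
  pos : 0 < δ
  le_half : δ ≤ 1 / 2
  meets : ∀ k, ∃ a ∈ gridThickComplement δ, ∃ b ∈ gridThickComplement δ,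
    f a ∈ halfCell k ∧ f b ∈ halfCell k ∧ ∃ i, ⌊a i⌋ ≠ ⌊b i⌋

/-! ### The initial stage -/

theorem quarter_le_norm_coe (c : ℤ) : 1 / 4 ≤ ‖((c / 2 - 1 / 4 : ℝ) : UnitAddCircle)‖ := by
  refine le_norm_coe_unitAddCircle fun m => ?_
  rw [le_abs]
  rcases le_or_gt (2 * m) (c - 1) with h | h
  · have : (2 * m : ℝ) ≤ c - 1 := mod_cast h
    left; linarith
  · have : (c : ℝ) ≤ 2 * m := by exact_mod_cast (by omega : c ≤ 2 * m)
    right; linarith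

theorem norm_coe_half_add_eighth (c : ℤ) :
    (‖((c / 2 + 1 / 8 : ℝ) : UnitAddCircle)‖ = 1 / 8 ∧
      ‖((c / 2 + 3 / 8 : ℝ) : UnitAddCircle)‖ = 3 / 8) ∨
    (‖((c / 2 + 1 / 8 : ℝ) : UnitAddCircle)‖ = 3 / 8 ∧
      ‖((c / 2 + 3 / 8 : ℝ) : UnitAddCircle)‖ = 1 / 8) := by
  rcases Int.even_or_odd' c with ⟨d, rfl | rfl⟩
  · left
    have h1 : ((2 * d : ℤ) / 2 + 1 / 8 : ℝ) - d = 1 / 8 := by push_cast; ring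
    have h2 : ((2 * d : ℤ) / 2 + 3 / 8 : ℝ) - d = 3 / 8 := by push_cast; ring
    constructor
    · rw [norm_coe_unitAddCircle_eq d] <;> rw [h1] <;> norm_num [abs_of_pos]
    · rw [norm_coe_unitAddCircle_eq d] <;> rw [h2] <;> norm_num [abs_of_pos]
  · right
    have h1 : ((2 * d + 1 : ℤ) / 2 + 1 / 8 : ℝ) - (d + 1 : ℤ) = -(3 / 8) := by push_cast; ring
    have h2 : ((2 * d + 1 : ℤ) / 2 + 3 / 8 : ℝ) - (d + 1 : ℤ) = -(1 / 8) := by push_cast; ring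
    constructor
    · rw [norm_coe_unitAddCircle_eq (d + 1)] <;> rw [h1, abs_neg] <;> norm_num [abs_of_pos]
    · rw [norm_coe_unitAddCircle_eq (d + 1)] <;> rw [h2, abs_neg] <;> norm_num [abs_of_pos]

/-- Shear horizontally by four times the distance of the height to the integers. Each cell contains
heights at distances 1/8 and 3/8, where the displacements are 1/2 and 3/2. Points of the cell at
these heights with the same abscissa thus come from abscissas that differ by one. -/
theorem exists_isStage : ∃ f δ, IsStage f δ := by
  let φ : C(UnitAddCircle, ℝ) := ⟨fun y => 4 * ‖y‖, by fun_prop⟩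
  have key : ∀ (k : Fin 2 → ℤ) (t : ℝ) (n : ℤ), 0 < t → t < 1 / 2 →
      ‖((k 1 / 2 + t : ℝ) : UnitAddCircle)‖ = (2 * n + 1) / 8 → 0 ≤ n →
      !₂[((k 0 - 2 * n : ℤ) : ℝ) / 2 - 1 / 4, k 1 / 2 + t] ∈ gridThickComplement (1 / 8) ∧
      planeShear 0 φ !₂[((k 0 - 2 * n : ℤ) : ℝ) / 2 - 1 / 4, k 1 / 2 + t] ∈ halfCell k := by
    intro k t n ht ht' hn hn0
    have hn0' : (0 : ℝ) ≤ n := mod_cast hn0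
    refine ⟨Fin.forall_fin_two.2 ⟨?_, ?_⟩, Fin.forall_fin_two.2 ⟨?_, ?_⟩⟩
    · exact (by norm_num : (1 / 8 : ℝ) ≤ 1 / 4).trans (quarter_le_norm_coe _)
    · change _ ≤ ‖((k 1 / 2 + t : ℝ) : UnitAddCircle)‖
      rw [hn]; linarith
    · have : planeShear 0 φ !₂[((k 0 - 2 * n : ℤ) : ℝ) / 2 - 1 / 4, k 1 / 2 + t] 0
          = k 0 / 2 + 1 / 4 := by
        rw [planeShear_apply_self]
        change ((k 0 - 2 * n : ℤ) : ℝ) / 2 - 1 / 4 +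
          4 * ‖((k 1 / 2 + t : ℝ) : UnitAddCircle)‖ = _
        rw [hn]; push_cast; ring
      rw [this]; constructor <;> linarith
    · have : planeShear 0 φ !₂[((k 0 - 2 * n : ℤ) : ℝ) / 2 - 1 / 4, k 1 / 2 + t] 1
          = k 1 / 2 + t := planeShear_apply_add_one 0 φ _
      rw [this]; constructor <;> linarith
  have floor_ne : ∀ (c : ℤ), ⌊((c - 2 * 0 : ℤ) : ℝ) / 2 - 1 / 4⌋ ≠
      ⌊((c - 2 * 1 : ℤ) : ℝ) / 2 - 1 / 4⌋ := fun c => by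
    have : ((c - 2 * 0 : ℤ) : ℝ) / 2 - 1 / 4 = ((c - 2 * 1 : ℤ) : ℝ) / 2 - 1 / 4 + 1 := by
      push_cast; ring
    rw [this, Int.floor_add_one]
    omega
  refine ⟨planeShear 0 φ, 1 / 8, coversMeasurePreserving_planeShear _ _, by norm_num, by norm_num,
    fun k => ?_⟩
  rcases norm_coe_half_add_eighth (k 1) with ⟨h1, h2⟩ | ⟨h1, h2⟩
  · have A := key k _ 0 (by norm_num) (by norm_num) (h1.trans (by norm_num)) le_rfl
    have B := key k _ 1 (by norm_num) (by norm_num) (h2.trans (by norm_num)) zero_le_one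
    exact ⟨_, A.1, _, B.1, A.2, B.2, 0, floor_ne (k 0)⟩
  · have A := key k _ 0 (by norm_num) (by norm_num) (h2.trans (by norm_num)) le_rfl
    have B := key k _ 1 (by norm_num) (by norm_num) (h1.trans (by norm_num)) zero_le_one
    exact ⟨_, A.1, _, B.1, A.2, B.2, 0, floor_ne (k 0)⟩

/-! ### The induction step and the sequence -/

theorem IsStage.exists_next {f : Plane ≃ₜ Plane} {δ : ℝ} (h : IsStage f δ) (k : Fin 2 → ℤ) :
    ∃ f' δ', IsStage f' δ' ∧ δ' ≤ δ / 2 ∧ EqOn f' f (gridThickComplement δ) ∧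
      ∃ q ∈ openUnitSquare ∩ gridThickComplement δ', f' q ∈ halfCell k := by
  obtain ⟨a, -, b, -, hfa, hfb, i, hi⟩ := h.meets k
  have hconn : IsPreconnected (f ⁻¹' halfCell k) :=
    f.isPreconnected_preimage.2 (convex_halfCell k).isPreconnected
  obtain ⟨p, hp, m, hpm⟩ := hconn.exists_eq_intCast hfa hfb hi
  obtain ⟨g, hg, hfix, q, hq, hgq⟩ := exists_fixing_gridThickComplement h.pos h.le_half hpm
  have heq : EqOn (g.trans f) f (gridThickComplement δ) := fun x hx => by simp [hfix x hx]
  have hδ := h.pos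
  obtain ⟨ε, hε, hqε⟩ := exists_mem_gridThickComplement hq
  have hmin := min_le_left (δ / 2) ε
  -- The bound by `ε` protects `q` from all later modifications; the bound by `δ / 2` forces
  -- convergence to zero.
  refine ⟨g.trans f, min (δ / 2) ε, ⟨hg.trans h.covers, lt_min (by linarith) hε,
    by linarith [h.le_half], fun k => ?_⟩, hmin, heq, q,
    ⟨hq, gridThickComplement_anti (min_le_right _ _) hqε⟩, by simpa [hgq] using hp⟩
  obtain ⟨a, ha, b, hb, hfa, hfb, hab⟩ := h.meets k
  have hsub := gridThickComplement_anti (show min (δ / 2) ε ≤ δ by linarith)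
  exact ⟨a, hsub ha, b, hsub hb, by rwa [heq ha], by rwa [heq hb], hab⟩

theorem exists_stage_sequence : ∃ (f : ℕ → Plane ≃ₜ Plane) (δ : ℕ → ℝ),
    (∀ n, IsStage (f n) (δ n)) ∧ Tendsto δ atTop (𝓝 0) ∧
    (∀ m n, m ≤ n → EqOn (f n) (f m) (gridThickComplement (δ m))) ∧
    ∀ k, ∃ n, ∃ q ∈ openUnitSquare ∩ gridThickComplement (δ n), f n q ∈ halfCell k := by
  obtain ⟨e, he⟩ := exists_surjective_nat (Fin 2 → ℤ)
  obtain ⟨f₀, δ₀, h₀⟩ := exists_isStage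
  let S := {p : (Plane ≃ₜ Plane) × ℝ // IsStage p.1 p.2}
  have step : ∀ (s : S) (k : Fin 2 → ℤ), ∃ t : S, t.1.2 ≤ s.1.2 / 2 ∧
      EqOn t.1.1 s.1.1 (gridThickComplement s.1.2) ∧
      ∃ q ∈ openUnitSquare ∩ gridThickComplement t.1.2, t.1.1 q ∈ halfCell k := by
    rintro ⟨⟨f, δ⟩, h⟩ k
    obtain ⟨f', δ', h', H⟩ := h.exists_next k
    exact ⟨⟨(f', δ'), h'⟩, H⟩
  choose next hhalf heq hmeet using step
  let s : ℕ → S := fun n => Nat.rec ⟨(f₀, δ₀), h₀⟩ (fun n s => next s (e n)) n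
  have hs : ∀ n, s (n + 1) = next (s n) (e n) := fun n => rfl
  have hpos : ∀ n, 0 < (s n).1.2 := fun n => (s n).2.pos
  have hsucc : ∀ n, (s (n + 1)).1.2 ≤ (s n).1.2 / 2 := fun n => by rw [hs]; exact hhalf _ _
  have hanti : Antitone fun n => (s n).1.2 :=
    antitone_nat_of_succ_le fun n => by linarith [hsucc n, hpos n]
  refine ⟨fun n => (s n).1.1, fun n => (s n).1.2, fun n => (s n).2, ?_, ?_, ?_⟩
  · have hle : ∀ n, (s n).1.2 ≤ δ₀ * (1 / 2) ^ n := by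
      intro n
      induction n with
      | zero => simp [s]
      | succ n ih => rw [pow_succ]; linarith [hsucc n]
    refine squeeze_zero (fun n => (hpos n).le) hle ?_
    simpa using (tendsto_pow_atTop_nhds_zero_of_lt_one (r := (1 / 2 : ℝ))
      (by norm_num) (by norm_num)).const_mul δ₀
  · intro m n hmn
    induction n, hmn using Nat.le_induction with
    | base => exact fun _ _ => rfl
    | succ n hmn ih =>
      intro x hx
      have := heq (s n) (e n) (gridThickComplement_anti (hanti hmn) hx)
      rw [← hs] at this
      exact this.trans (ih hx)
  · intro k
    obtain ⟨n, rfl⟩ := he k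
    exact ⟨n + 1, hmeet (s n) (e n)⟩

/-! ### The limit map -/

theorem Topology.IsOpenEmbedding.isSimplyConnected_range {X Y : Type*} [TopologicalSpace X]
    [TopologicalSpace Y] [SimplyConnectedSpace X] {f : X → Y} (hf : IsOpenEmbedding f) :
    IsSimplyConnected (range f) :=
  hf.isEmbedding.toHomeomorph.toHomotopyEquiv.simplyConnectedSpace_iff.1 inferInstance

instance : SimplyConnectedSpace openUnitSquare :=
  have : ContractibleSpace openUnitSquare := convex_openUnitSquare.contractibleSpace
    ⟨WithLp.toLp 2 fun _ => 1 / 2, fun _ => by norm_num⟩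
  inferInstance

theorem continuous_coe_apply (i : Fin 2) : Continuous fun x : Plane => (x i : UnitAddCircle) :=
  (AddCircle.continuous_mk' 1).comp (by fun_prop)

/-- A map which near every point agrees with some homeomorphism is continuous and open. -/
theorem continuous_isOpenMap_of_locally_homeomorph {s : Set Plane} (hs : IsOpen s) {h : s → Plane}
    (H : ∀ x : s, ∃ f : Plane ≃ₜ Plane, ∀ᶠ y in 𝓝 x, h y = f y) :
    Continuous h ∧ IsOpenMap h := by
  constructor
  · refine continuous_iff_continuousAt.2 fun x => ?_
    obtain ⟨f, hf⟩ := H x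
    exact ContinuousAt.congr (f.continuous.comp continuous_subtype_val).continuousAt
      (hf.mono fun y hy => hy.symm)
  · refine IsOpenMap.of_nhds_le fun x => ?_
    obtain ⟨f, hf⟩ := H x
    have hf' : h =ᶠ[𝓝 x] f ∘ Subtype.val := hf
    rw [hf'.eq_of_nhds, Filter.map_congr hf']
    exact (f.isOpenMap.comp hs.isOpenMap_subtype_val).nhds_le x

theorem exists_limit {f : ℕ → Plane ≃ₜ Plane} {δ : ℕ → ℝ}
    (hδ : Tendsto δ atTop (𝓝 0))
    (hf : ∀ m n, m ≤ n → EqOn (f n) (f m) (gridThickComplement (δ m))) :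
    ∃ h : openUnitSquare → Plane, Continuous h ∧ IsOpenMap h ∧
      ∀ n (x : openUnitSquare), x.1 ∈ gridThickComplement (δ n) → h x = f n x := by
  have hex : ∀ x : openUnitSquare, ∃ n, ∀ᶠ y in 𝓝 x, y.1 ∈ gridThickComplement (δ n) := by
    intro x
    obtain ⟨ε, hε, hx⟩ := exists_mem_gridThickComplement x.2
    -- The strict inequality `δ n < ε` leaves room for a whole neighbourhood of `x`.
    obtain ⟨n, hn⟩ := (hδ.eventually_lt_const hε).exists
    refine ⟨n, eventually_all.2 fun i => ?_⟩
    have hc : Continuous fun y : openUnitSquare => ‖(y.1 i : UnitAddCircle)‖ :=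
      ((continuous_coe_apply i).comp continuous_subtype_val).norm
    exact (hc.continuousAt.eventually_const_lt (hn.trans_le (hx i))).mono fun y hy => hy.le
  choose N hN using hex
  have key : ∀ n (x : openUnitSquare), x.1 ∈ gridThickComplement (δ n) → f (N x) x = f n x := by
    intro n x hx
    have hx' := (hN x).self_of_nhds
    rcases le_total n (N x) with hle | hle
    · exact hf _ _ hle hx
    · exact (hf _ _ hle hx').symm
  obtain ⟨h1, h2⟩ := continuous_isOpenMap_of_locally_homeomorph isOpen_openUnitSquare
    (h := fun x => f (N x) x) fun x => ⟨f (N x), (hN x).mono fun y hy => key _ _ hy⟩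
  exact ⟨_, h1, h2, key⟩

/-! ### Measure of the grid neighbourhood in the torus -/

theorem volume_exists_norm_lt_le (δ : ℝ) :
    volume {y : UnitAddTorus (Fin 2) | ∃ i, ‖y i‖ < δ} ≤ ENNReal.ofReal (2 * δ) * 2 := by
  have h1 : ∀ i : Fin 2,
      volume {y : UnitAddTorus (Fin 2) | ‖y i‖ < δ} ≤ ENNReal.ofReal (2 * δ) := by
    intro i
    have : IsProbabilityMeasure (volume : Measure UnitAddCircle) := ⟨UnitAddCircle.measure_univ⟩
    have hm := measurePreserving_eval (fun _ : Fin 2 => (volume : Measure UnitAddCircle)) i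
    have hs : MeasurableSet {z : UnitAddCircle | ‖z‖ < δ} :=
      (isOpen_lt continuous_norm continuous_const).measurableSet
    have := hm.measure_preimage hs.nullMeasurableSet
    refine (this.trans_le ?_)
    refine (measure_mono (t := Metric.closedBall 0 δ) fun z hz => ?_).trans ?_
    · simpa using (le_of_lt hz)
    · rw [AddCircle.volume_closedBall]
      exact ENNReal.ofReal_le_ofReal (min_le_right _ _)
  have : {y : UnitAddTorus (Fin 2) | ∃ i, ‖y i‖ < δ} ⊆ ⋃ i, {y | ‖y i‖ < δ} := fun y hy => by
    simpa using hy
  refine (measure_mono this).trans ((measure_iUnion_fintype_le _ _).trans ?_)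
  refine (Finset.sum_le_card_nsmul _ _ _ fun i _ => h1 i).trans ?_
  simp [mul_comm]

theorem exists_openUnitSquare_of_norm_pos {y : UnitAddTorus (Fin 2)} (hy : ∀ i, 0 < ‖y i‖) :
    ∃ x ∈ openUnitSquare, torusProj x = y := by
  obtain ⟨x, rfl⟩ := torusProj_surjective y
  refine ⟨WithLp.toLp 2 fun i => Int.fract (x i), fun i => ⟨?_, Int.fract_lt_one _⟩, ?_⟩
  · refine lt_of_le_of_ne (Int.fract_nonneg _) fun h => (hy i).ne' ?_
    have hx : x i = ⌊x i⌋ := by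
      have := Int.self_sub_floor (x i)
      simp only at h
      linarith
    change ‖(x i : UnitAddCircle)‖ = 0
    rw [hx, norm_coe_unitAddCircle_int]
  · ext i
    change ((Int.fract (x i) : ℝ) : UnitAddCircle) = (x i : UnitAddCircle)
    rw [Int.fract, AddCircle.coe_sub, coe_intCast_unitAddCircle, sub_zero]

/-! ### Accumulation at infinity -/

theorem norm_le_two_of_mem_unitSquare {x : Plane} (hx : x ∈ unitSquare) : ‖x‖ ≤ 2 := by
  have h : ∀ i, x i ^ 2 ≤ 1 := fun i => by
    have := hx i
    nlinarith [this.1, this.2]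
  rw [EuclideanSpace.norm_eq, Real.sqrt_le_iff]
  simp only [Fin.sum_univ_two, Real.norm_eq_abs, sq_abs]
  constructor <;> linarith [h 0, h 1]

/-- Points chosen in the squares based at `n • v` stay within bounded distance of `n • v`. -/
theorem accumulatesInDirection_of_meets_unitSquares {U : Set Plane}
    (hU : ∀ v : Plane, (U ∩ (v +ᵥ unitSquare)).Nonempty) {v : Plane} (hv : ‖v‖ = 1) :
    AccumulatesInDirection U v := by
  choose x hxU hx using fun n : ℕ => hU ((n : ℝ) • v)
  have hb : ∀ n, ‖x n - (n : ℝ) • v‖ ≤ 2 := by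
    intro n
    obtain ⟨z, hz, hzx⟩ := hx n
    rw [← hzx]
    simpa using norm_le_two_of_mem_unitSquare hz
  refine ⟨x, hxU, ?_, ?_⟩
  · refine tendsto_atTop_mono (f := fun n : ℕ => (n : ℝ) - 2) (fun n => ?_)
      (tendsto_atTop_add_const_right _ _ tendsto_natCast_atTop_atTop)
    have h1 : ‖(n : ℝ) • v‖ = n := by rw [norm_smul, hv]; simp
    have h2 := norm_sub_norm_le ((n : ℝ) • v) (x n)
    rw [norm_sub_rev] at h2
    linarith [hb n]
  · have hinv : Tendsto (fun n : ℕ => (n : ℝ)⁻¹) atTop (𝓝 0) := tendsto_inv_atTop_nhds_zero_nat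
    have hz : Tendsto (fun n : ℕ => (n : ℝ)⁻¹ • (x n - (n : ℝ) • v - x 0)) atTop (𝓝 0) := by
      refine squeeze_zero_norm (a := fun n : ℕ => (n : ℝ)⁻¹ * (2 + ‖x 0‖)) (fun n => ?_)
        (by simpa using hinv.mul_const (2 + ‖x 0‖))
      rw [norm_smul, Real.norm_of_nonneg (by positivity)]
      gcongr
      exact (norm_sub_le _ _).trans (by linarith [hb n])
    have hlim : Tendsto (fun n : ℕ => (n : ℝ)⁻¹ • (x n - x 0)) atTop (𝓝 v) := by
      have := hz.const_add v
      rw [add_zero] at this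
      refine this.congr' ?_
      filter_upwards [eventually_gt_atTop 0] with n hn
      have : (n : ℝ) ≠ 0 := by positivity
      rw [sub_right_comm, smul_sub _ (x n - x 0), smul_smul, inv_mul_cancel₀ this, one_smul]
      abel
    -- Since `(x n - x 0) / n → v` with `‖v‖ = 1`, dividing by the norm of the left side keeps the
    -- limit and cancels the factor `n`.
    have hlim' := (hlim.norm.inv₀ (by simp [hv])).smul hlim
    rw [hv, inv_one, one_smul] at hlim'
    refine hlim'.congr' ?_
    filter_upwards [eventually_gt_atTop 0] with n hn
    have : (n : ℝ) ≠ 0 := by positivity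
    rw [norm_smul, norm_inv, RCLike.norm_natCast, mul_inv, inv_inv, smul_smul, mul_right_comm,
      mul_inv_cancel₀ this, one_mul]

/-! ### Assembly -/

theorem theorem2 :
    ∃ U : Set Plane,
      IsOpen U ∧
      (IsConnected U ∧ IsSimplyConnected U) ∧
      (IsSimplyConnected (torusProj '' U) ∧
        ∀ v : Fin 2 → ℤ, v ≠ 0 → Disjoint U (latticePoint v +ᵥ U)) ∧
      ((∀ v : Plane, (U ∩ (v +ᵥ unitSquare)).Nonempty) ∧
        ∀ v : Plane, ‖v‖ = 1 → AccumulatesInDirection U v) ∧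
      volume (torusProj '' U)ᶜ = 0 := by
  obtain ⟨f, δ, hstage, hδ, hf, hmeet⟩ := exists_stage_sequence
  obtain ⟨h, hcont, hopen, hlim⟩ := exists_limit hδ hf
  have hinj : Function.Injective (torusProj ∘ h) := by
    intro x y hxy
    obtain ⟨ε, hε, hx⟩ := exists_mem_gridThickComplement x.2
    obtain ⟨ε', hε', hy⟩ := exists_mem_gridThickComplement y.2
    -- At a common stage `n`, `h` agrees with `f n` at both points, so injectivity reduces to that
    -- of `F` and of the projection on the open square.
    obtain ⟨n, hn, hn'⟩ :=
      ((hδ.eventually_lt_const hε).and (hδ.eventually_lt_const hε')).exists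
    obtain ⟨F, -, hF⟩ := (hstage n).covers
    rw [Function.comp_apply, Function.comp_apply, hlim n x (gridThickComplement_anti hn.le hx),
      hlim n y (gridThickComplement_anti hn'.le hy), hF, hF] at hxy
    exact Subtype.ext (injOn_torusProj_openUnitSquare x.2 y.2 (F.injective hxy))
  have hemb : IsOpenEmbedding h := .of_continuous_injective_isOpenMap hcont hinj.of_comp hopen
  have hemb' : IsOpenEmbedding (torusProj ∘ h) := .of_continuous_injective_isOpenMap
    (continuous_torusProj.comp hcont) hinj (isOpenMap_torusProj.comp hopen)
  have hsc := hemb.isSimplyConnected_range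
  have hsquares : ∀ v : Plane, (range h ∩ (v +ᵥ unitSquare)).Nonempty := by
    intro v
    obtain ⟨k, hk⟩ := exists_halfCell_subset_vadd_unitSquare v
    obtain ⟨n, q, ⟨hq, hqn⟩, hfq⟩ := hmeet k
    exact ⟨h ⟨q, hq⟩, mem_range_self _, hk (by rwa [hlim n ⟨q, hq⟩ hqn])⟩
  refine ⟨range h, hemb.isOpen_range, ⟨hsc.isPathConnected.isConnected, hsc⟩, ⟨?_, ?_⟩,
    ⟨hsquares, fun v hv => accumulatesInDirection_of_meets_unitSquares hsquares hv⟩, ?_⟩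
  · rw [← range_comp]
    exact hemb'.isSimplyConnected_range
  · intro v hv
    refine disjoint_left.2 ?_
    rintro _ ⟨x, rfl⟩ ⟨_, ⟨y, rfl⟩, hxy⟩
    have hxy' : latticePoint v +ᵥ h y = h x := hxy
    obtain rfl : y = x := hinj (by
      rw [Function.comp_apply, Function.comp_apply, ← hxy', torusProj_latticePoint_vadd])
    refine hv (funext fun i => ?_)
    have : latticePoint v = 0 := by simpa using hxy'
    simpa [latticePoint] using congrArg (fun z : Plane => z i) this
  · have hle : ∀ n, volume (torusProj '' range h)ᶜ ≤ ENNReal.ofReal (2 * δ n) * 2 := by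
      intro n
      obtain ⟨F, hF, hFf⟩ := (hstage n).covers
      -- Pulled back by `F`, the complement avoids every torus point at distance at least `δ n` from
      -- the grid: such a point lifts to the open square, where `h` agrees with `f n`.
      rw [← hF.measure_preimage_equiv (f := F.toMeasurableEquiv)]
      refine (measure_mono fun y hy => ?_).trans (volume_exists_norm_lt_le (δ n))
      by_contra hcon
      have hcon' : ∀ i, δ n ≤ ‖y i‖ := by simpa using hcon
      obtain ⟨x, hx, rfl⟩ :=
        exists_openUnitSquare_of_norm_pos fun i => (hstage n).pos.trans_le (hcon' i)
      refine hy ⟨_, mem_range_self ⟨x, hx⟩, ?_⟩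
      rw [hlim n ⟨x, hx⟩ hcon', hFf]
      rfl
    have := ENNReal.Tendsto.mul_const (b := 2) (ENNReal.tendsto_ofReal (hδ.const_mul 2))
      (Or.inr (by norm_num))
    exact le_antisymm (ge_of_tendsto' (by simpa using this) hle) zero_le
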